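/- **Proposition 4.** A parallel affine routing problem $G$ consists of finitely many parallel edges $e$ joining one origin to one destination, with latency functions $\ell_e(x)=a_e x+b_e$, $a_e,b_e\ge 0$, and a population $N=[0,r]$ (with Lebesgue measure, $r>0$) of non-atomic users. A flow $f=(f_e)_e$, $f_e\ge 0$, $\sum_e f_e=r$, has total latency $\mathcal L(f)=\sum_e f_e\,\ell_e(f_e)$, and $\mathcal L^{\rm opt}(G)$ is its minimum over all such flows. Given sensitivities $s:N\to(0,\infty)$ and incentive functions $\tau_e$, a Nash flow is a flow induced by a (measurable) choice of an edge for each user such that every user $x$ is on an edge that minimizes $\ell_e(f_e)+s_x\tau_e(f_e)$. Let $\mathcal G^{\rm pa}$ be the class of parallel affine routing problems that have a Nash flow without incentives with positive traffic on every edge. Let $0<S_L\le S_U$ and let $\mathcal S$ be the set of all sensitivity distributions $s:N\to[S_L,S_U]$. For a mechanism $T$ that assigns an incentive function to each affine latency function, let $$\mathrm{PoA}(G,\mathcal S,T)=\sup_{s\in\mathcal S}\frac{\mathcal L^{\rm Nash}(G,s,T)}{\mathcal L^{\rm opt}(G)},\qquad \mathrm{PoA}(\mathcal G^{\rm pa},\mathcal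 S,T)=\sup_{G\in\mathcal G^{\rm pa}}\mathrm{PoA}(G,\mathcal S,T),$$ where $\mathcal L^{\rm Nash}(G,s,T)$ is the highest total latency of a Nash flow (and $0/0:=0$). Let $T^-(k_1,k_2)$ denote the affine subsidy mechanism that assigns $\tau_e(x)=k_1a_ex+k_2b_e$. For any $\beta>0$, the pair $$k_1^*=0,\qquad k_2^*=-\min\Big\{\beta,\frac1{S_L+S_U}\Big\}$$ satisfies $$(k_1^*,k_2^*)\in\operatorname*{arg\,min}_{-\beta\le k_1,k_2\le 0}\mathrm{PoA}\big(\mathcal G^{\rm pa},\mathcal S,T^-(k_1,k_2)\big),$$ and it is the only minimizer if $S_L<S_U$ or $\beta\le\frac1{S_L+S_U}$. Furthermore, for every $G\in\mathcal G^{\rm pa}$, $\mathrm{PoA}(G,\mathcal S,T^-(k_1^*,k_2^*))$ is at most $$\frac43\big(1-\beta S_L(1-\beta S_L)\big)\ \text{ if }\beta<\frac1{S_L+S_U},\qquad \frac43\Big(1-\frac{S_L/S_U}{(1+S_L/S_U)^2}\Big)\ \text{ if }\beta\ge\frac1{S_L+S_U}.$$ -/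

import Mathlib

open MeasureTheory Set
open scoped ENNReal

/-- An affine latency function `x ↦ a * x + b` with `a, b ≥ 0`, recorded by its coefficients
(which it determines). -/
structure AffineLatency where
  a : ℝ
  b : ℝ
  a_nonneg : 0 ≤ a
  b_nonneg : 0 ≤ b

namespace AffineLatency

/-- The delay on an edge with latency function `ℓ` that carries traffic of mass `x`. -/
def eval (ℓ : AffineLatency) (x : ℝ) : ℝ := ℓ.a * x + ℓ.b

end AffineLatency

/-- A network-agnostic incentive mechanism on affine latencies: the incentive function assigned to
an edge depends on the latency function of that edge only.  The incentive is added to the cost, so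
it is a toll where it is nonnegative and a subsidy where it is nonpositive. -/
abbrev IncentiveMechanism : Type := AffineLatency → ℝ → ℝ

/-- No incentive. -/
def noIncentive : IncentiveMechanism := fun _ _ => 0

/-- The affine mechanism `T(k₁, k₂)`, which assigns `τ(x) = k₁ a x + k₂ b` to the latency function
`a x + b`. -/
def affineMechanism (k₁ k₂ : ℝ) : IncentiveMechanism := fun ℓ x => k₁ * ℓ.a * x + k₂ * ℓ.b

/-- A routing problem on a parallel network with affine latencies: one origin, one destination,
`n` parallel edges (each of them is a path), and traffic of mass `r > 0`. -/
structure ParallelGame where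
  n : ℕ
  latency : Fin n → AffineLatency
  r : ℝ
  r_pos : 0 < r

namespace ParallelGame

variable (G : ParallelGame)

/-- The non-atomic users: a closed interval of Lebesgue measure `r`. -/
abbrev Users : Type := Icc (0 : ℝ) G.r

/-- Lebesgue measure on the interval of users. -/
noncomputable def userMeasure : Measure G.Users := (volume : Measure ℝ).comap Subtype.val

/-- Feasible flows: the traffic of mass `r` is split among the edges. -/
def IsFeasible (f : Fin G.n → ℝ) : Prop := (∀ e, 0 ≤ f e) ∧ ∑ e, f e = G.r

/-- Total latency of a flow. -/
def totalLatency (f : Fin G.n → ℝ) : ℝ := ∑ e, f e * (G.latency e).eval (f e)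

/-- The cost that a user of sensitivity `σ` observes on edge `e` in the flow `f`. -/
def cost (T : IncentiveMechanism) (σ : ℝ) (f : Fin G.n → ℝ) (e : Fin G.n) : ℝ :=
  (G.latency e).eval (f e) + σ * T (G.latency e) (f e)

/-- `f` is a Nash flow for the mechanism `T` and the users' sensitivities `s`: it is induced by a
choice `P` of an edge for every user (Lebesgue measurable, so that the masses make sense) in which
each user is on an edge of least cost to that user. -/
def IsNashFlow (s : G.Users → ℝ) (T : IncentiveMechanism) (f : Fin G.n → ℝ) : Prop :=
  ∃ P : G.Users → Fin G.n,
    (∀ e, NullMeasurableSet {x | P x = e} G.userMeasure) ∧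
    (∀ e, f e = G.userMeasure.real {x | P x = e}) ∧
    ∀ x e, G.cost T (s x) f (P x) ≤ G.cost T (s x) f e

/-- Every edge has positive traffic in an untolled Nash flow (the sensitivities play no role
without incentives). -/
def FullyUtilized : Prop :=
  ∃ f, G.IsNashFlow (fun _ => 1) noIncentive f ∧ ∀ e, 0 < f e

/-- The total latency of an optimal flow. -/
noncomputable def optLatency : ℝ≥0∞ :=
  ⨅ (f : Fin G.n → ℝ) (_ : G.IsFeasible f), ENNReal.ofReal (G.totalLatency f)

/-- The highest total latency in a Nash flow. -/
noncomputable def nashLatency (s : G.Users → ℝ) (T : IncentiveMechanism) : ℝ≥0∞ :=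
  ⨆ (f : Fin G.n → ℝ) (_ : G.IsNashFlow s T f), ENNReal.ofReal (G.totalLatency f)

/-- The price of anarchy of `T` in the single routing problem `G`, over all sensitivity
distributions with values in `[SL, SU]`. -/
noncomputable def poa (SL SU : ℝ) (T : IncentiveMechanism) : ℝ≥0∞ :=
  ⨆ (s : G.Users → ℝ) (_ : ∀ x, s x ∈ Icc SL SU), G.nashLatency s T / G.optLatency

end ParallelGame

/-- The class of fully utilized parallel affine congestion games. -/
def parallelAffineGames : Set ParallelGame := {G | G.FullyUtilized}

/-- The price of anarchy of `T` over a family of routing problems and all sensitivity distributions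
with values in `[SL, SU]`. -/
noncomputable def familyPoA (𝒢 : Set ParallelGame) (SL SU : ℝ) (T : IncentiveMechanism) : ℝ≥0∞ :=
  ⨆ G ∈ 𝒢, ParallelGame.poa G SL SU T

/-- The pairs `(k₁, k₂)` with `-β ≤ k₁, k₂ ≤ 0` that minimize the price of anarchy of the affine
subsidy mechanism `T(k₁, k₂)` over the fully utilized parallel affine games. -/
def optimalSubsidyCoeffs (SL SU β : ℝ) : Set (ℝ × ℝ) :=
  {k | k ∈ Icc (-β) 0 ×ˢ Icc (-β) 0 ∧
    IsMinOn (fun k : ℝ × ℝ => familyPoA parallelAffineGames SL SU (affineMechanism k.1 k.2))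
      (Icc (-β) 0 ×ˢ Icc (-β) 0) k}

/-!
Let `x` be the flow without incentives, of common delay `λ`, and let `y` be the flow of the same
mass for which all `a e * y e` agree. Every feasible flow `g` satisfies
`L(g) = λ r - ∑ a (g - x) (y - g)`, so the optimum is the midpoint of `x` and `y`, and
`L(g) ≥ λ r - D / 4` with `D = ∑ a (y - x) ^ 2 ≤ λ r`. Under the subsidy `-κ b` a user of
sensitivity `s` steers from `x` towards `y` with weight `κ s`. If all weights lie in `[q, 1 - q]`,
then `a (g - x) - q a (y - x)` and `(1 - q) a (y - x) - a (g - x)` are similarly ordered over the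
edges at a Nash flow `g`, and Chebyshev's sum inequality gives `L(g) ≤ λ r - q (1 - q) D`. Hence
the price of anarchy is at most `4 / 3 * (1 - q (1 - q))`.

Pigou's network with latencies `x` and `b → 1`, in which homogeneous users send a share `ρ` to the
first edge, shows that it is at least `4 / 3 * (1 - ρ (1 - ρ))`. For `q = κ SL`, every pair other
than `(0, -κ)` makes the users of sensitivity `SL` choose a share of at least `1 - q`, or those of
sensitivity `SU` a share of at most `q`.
-/

open Filter
open scoped Topology

section Sums

variable {ι : Type*} [Fintype ι]

theorem sum_weight_mul_sum_le_of_monovary {R : Type*} [CommRing R] [LinearOrder R]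
    [IsStrictOrderedRing R] {w f g : ι → R} (hw : ∀ i, 0 ≤ w i) (hfg : Monovary f g) :
    (∑ i, w i * f i) * ∑ i, w i * g i ≤ (∑ i, w i) * ∑ i, w i * (f i * g i) := by
  have hpairs : 0 ≤ ∑ i, ∑ j, w i * w j * ((f j - f i) * (g j - g i)) :=
    Finset.sum_nonneg fun i _ => Finset.sum_nonneg fun j _ =>
      mul_nonneg (mul_nonneg (hw i) (hw j)) (hfg.sub_mul_sub_nonneg i j)
  have hexpand : ∑ i, ∑ j, w i * w j * ((f j - f i) * (g j - g i)) =
      2 * ((∑ i, w i) * ∑ i, w i * (f i * g i) - (∑ i, w i * f i) * ∑ i, w i * g i) := by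
    have hterm : ∀ i j, w i * w j * ((f j - f i) * (g j - g i)) =
        w i * (w j * (f j * g j)) + w i * (f i * g i) * w j
          - w i * f i * (w j * g j) - w i * g i * (w j * f j) := fun i j => by ring
    simp only [hterm, Finset.sum_sub_distrib, Finset.sum_add_distrib, ← Finset.mul_sum,
      ← Finset.sum_mul]
    ring
  linarith

variable {𝕜 : Type*} [Field 𝕜] [LinearOrder 𝕜] [IsStrictOrderedRing 𝕜]

theorem sum_mul_mul_nonneg_of_monovary {a u v : ι → 𝕜} (ha : ∀ i, 0 ≤ a i) (hu : ∑ i, u i = 0)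
    (h : Monovary (fun i => a i * u i) fun i => a i * v i) : 0 ≤ ∑ i, a i * (u i * v i) := by
  by_cases hc : ∃ c, a c = 0
  · obtain ⟨c, hc⟩ := hc
    refine Finset.sum_nonneg fun i _ => ?_
    rcases (ha i).eq_or_lt with hi | hi
    · simp [← hi]
    · have hic := h.sub_mul_sub_nonneg c i
      simp only [hc, zero_mul, sub_zero] at hic
      exact nonneg_of_mul_nonneg_right (by linarith : 0 ≤ a i * (a i * (u i * v i))) hi
  · push Not at hc
    have hpos : ∀ i, 0 < a i := fun i => (ha i).lt_of_ne (hc i).symm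
    have hcheb := sum_weight_mul_sum_le_of_monovary (fun i => (inv_pos.2 (hpos i)).le) h
    have hterm : ∀ i, (a i)⁻¹ * (a i * u i * (a i * v i)) = a i * (u i * v i) := fun i => by
      field_simp [hc i]
    simp only [inv_mul_cancel_left₀ (hc _), hu, zero_mul, hterm] at hcheb
    rcases isEmpty_or_nonempty ι with _ | _
    · simp
    · exact nonneg_of_mul_nonneg_right hcheb
        (Finset.sum_pos (fun i _ => inv_pos.2 (hpos i)) Finset.univ_nonempty)

theorem exists_mul_eq_const_of_sum_eq [Nonempty ι] {a : ι → 𝕜} (ha : ∀ i, 0 ≤ a i) (r : 𝕜) :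
    ∃ (y : ι → 𝕜) (t : 𝕜), (∀ i, a i * y i = t) ∧ ∑ i, y i = r := by
  classical
  by_cases hc : ∃ c, a c = 0
  · obtain ⟨c, hc⟩ := hc
    refine ⟨Pi.single c r, 0, fun i => ?_, Finset.sum_pi_single' c r _ |>.trans (by simp)⟩
    rcases eq_or_ne i c with rfl | hi
    · simp [hc]
    · simp [hi]
  · push Not at hc
    have hpos : ∀ i, 0 < a i := fun i => (ha i).lt_of_ne (hc i).symm
    have hW : 0 < ∑ i, (a i)⁻¹ :=
      Finset.sum_pos (fun i _ => inv_pos.2 (hpos i)) Finset.univ_nonempty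
    exact ⟨fun i => (a i)⁻¹ * (r / ∑ i, (a i)⁻¹), r / ∑ i, (a i)⁻¹,
      fun i => mul_inv_cancel_left₀ (hc i) _, by
        rw [← Finset.sum_mul, mul_div_cancel₀ _ hW.ne']⟩

end Sums

theorem exists_Ioc_partition {α : Type*} [AddCommGroup α] [LinearOrder α] [IsOrderedAddMonoid α]
    {n : ℕ} {f : Fin n → α} (hf : ∀ e, 0 ≤ f e) :
    ∃ S : Fin n → α, Pairwise (Function.onFun Disjoint fun e => Ioc (S e) (S e + f e)) ∧
      ⋃ e, Ioc (S e) (S e + f e) = Ioc 0 (∑ e, f e) := by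
  let F : ℕ → α := fun i => if h : i < n then f ⟨i, h⟩ else 0
  let S : ℕ → α := fun k => ∑ i ∈ Finset.range k, F i
  have hF : ∀ e : Fin n, F e = f e := fun e => by simp [F]
  have hS : Monotone S := monotone_nat_of_le_succ fun k => by
    simp only [S, Finset.sum_range_succ, le_add_iff_nonneg_right, F]
    split_ifs
    exacts [hf _, le_rfl]
  have hIoc : ∀ e : Fin n, Ioc (S e) (S e + f e) = Ioc (S e) (S (Order.succ (e : ℕ))) := fun e => by
    rw [Nat.succ_eq_succ, ← hF e]
    simp only [S, Nat.succ_eq_add_one, Finset.sum_range_succ]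
  refine ⟨fun e => S e, ?_, ?_⟩
  · simp only [hIoc]
    exact hS.pairwise_disjoint_on_Ioc_succ.comp_of_injective Fin.val_injective
  · have hunion := hS.biUnion_Ico_Ioc_map_succ 0 n
    have hn : S n = ∑ e, f e := by simp only [← hF, Fin.sum_univ_eq_sum_range F n, S]
    rw [hn, show S 0 = 0 from Finset.sum_range_zero _] at hunion
    rw [← hunion]
    ext z
    simp only [hIoc, mem_iUnion, Fin.exists_iff, mem_Ico, zero_le, true_and]

namespace ParallelGame

variable {G : ParallelGame}

section Users

theorem userMeasure_real_preimage {A : Set ℝ} (hA : A ⊆ Icc 0 G.r) :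
    G.userMeasure.real (Subtype.val ⁻¹' A) = volume.real A := by
  rw [measureReal_def, userMeasure, (MeasurableEmbedding.subtype_coe measurableSet_Icc).comap_apply,
    Subtype.image_preimage_coe, inter_eq_right.2 hA, measureReal_def]

instance : IsFiniteMeasure G.userMeasure := by
  refine ⟨?_⟩
  rw [userMeasure, (MeasurableEmbedding.subtype_coe measurableSet_Icc).comap_apply]
  exact (measure_mono (Subtype.coe_image_subset _ _)).trans_lt measure_Icc_lt_top

theorem userMeasure_real_univ : G.userMeasure.real univ = G.r := by
  have h := userMeasure_real_preimage (G := G) Subset.rfl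
  rwa [Subtype.coe_preimage_self, Real.volume_real_Icc_of_le G.r_pos.le, sub_zero] at h

theorem ae_userMeasure_pos : ∀ᵐ x : G.Users ∂G.userMeasure, 0 < (x : ℝ) := by
  have h := userMeasure_real_preimage (G := G) (singleton_subset_iff.2 ⟨le_rfl, G.r_pos.le⟩)
  rw [measureReal_def volume, Real.volume_singleton, ENNReal.toReal_zero,
    measureReal_eq_zero_iff] at h
  filter_upwards [compl_mem_ae_iff.2 h] with x hx
  exact x.2.1.lt_of_ne (Ne.symm hx)

theorem IsNashFlow.isFeasible {s : G.Users → ℝ} {T : IncentiveMechanism} {f : Fin G.n → ℝ}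
    (hf : G.IsNashFlow s T f) : G.IsFeasible f := by
  obtain ⟨P, hP, hfP, -⟩ := hf
  refine ⟨fun e => hfP e ▸ measureReal_nonneg, ?_⟩
  have hdisj : Set.Pairwise ((Finset.univ : Finset (Fin G.n)) : Set (Fin G.n))
      (Function.onFun (AEDisjoint G.userMeasure) fun e => {x | P x = e}) := fun i _ j _ hij =>
    (Set.disjoint_left.2 fun _ hi hj => hij (hi.symm.trans hj)).aedisjoint
  have hcover : ⋃ e ∈ Finset.univ, {x | P x = e} = univ := by
    ext x
    simp
  simp only [hfP, ← measureReal_biUnion_finset₀ hdisj fun e _ => hP e, hcover,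
    userMeasure_real_univ]

theorem IsFeasible.exists_assignment {f : Fin G.n → ℝ} (hf : G.IsFeasible f) :
    ∃ P : G.Users → Fin G.n, (∀ e, NullMeasurableSet {x | P x = e} G.userMeasure) ∧
      (∀ e, f e = G.userMeasure.real {x | P x = e}) ∧ ∀ x, 0 < f (P x) := by
  obtain ⟨S, hdisj, hunion⟩ := exists_Ioc_partition hf.1
  rw [hf.2] at hunion
  obtain ⟨e₀, -, he₀⟩ : ∃ e ∈ Finset.univ, 0 < f e :=
    Finset.exists_lt_of_sum_lt (by simpa [hf.2] using G.r_pos)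
  have hchoice : ∀ x : G.Users, ∃ e, 0 < f e ∧ (0 < (x : ℝ) → (x : ℝ) ∈ Ioc (S e) (S e + f e)) := by
    intro x
    rcases x.2.1.eq_or_lt with hx | hx
    · exact ⟨e₀, he₀, fun h => absurd hx h.ne⟩
    · obtain ⟨e, he⟩ := mem_iUnion.1 (hunion.ge ⟨hx, x.2.2⟩)
      exact ⟨e, by linarith [he.1, he.2], fun _ => he⟩
  choose P hpos hP using hchoice
  have hae : ∀ e, {x | P x = e} =ᵐ[G.userMeasure] Subtype.val ⁻¹' Ioc (S e) (S e + f e) := by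
    intro e
    filter_upwards [ae_userMeasure_pos] with x hx
    refine propext ⟨fun h => h ▸ hP x hx, fun h => ?_⟩
    by_contra hne
    exact Set.disjoint_left.1 (hdisj hne) (hP x hx) h
  refine ⟨P, fun e => ?_, fun e => ?_, hpos⟩
  · exact (measurable_subtype_coe measurableSet_Ioc).nullMeasurableSet.congr (hae e).symm
  · have hsub : Ioc (S e) (S e + f e) ⊆ Icc 0 G.r :=
      (subset_iUnion _ e).trans (hunion.le.trans Ioc_subset_Icc_self)
    rw [measureReal_congr (hae e), userMeasure_real_preimage hsub,
      Real.volume_real_Ioc_of_le (by linarith [hf.1 e]), add_sub_cancel_left]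

theorem IsFeasible.isNashFlow_const {T : IncentiveMechanism} {σ : ℝ} {f : Fin G.n → ℝ}
    (hf : G.IsFeasible f) (hmin : ∀ e, 0 < f e → ∀ e', G.cost T σ f e ≤ G.cost T σ f e') :
    G.IsNashFlow (fun _ => σ) T f := by
  obtain ⟨P, hP, hfP, hpos⟩ := hf.exists_assignment
  exact ⟨P, hP, hfP, fun x => hmin _ (hpos x)⟩

end Users

section UpperBound

variable {x y f g : Fin G.n → ℝ} {lam t κ q : ℝ} {s : G.Users → ℝ}

theorem FullyUtilized.exists_eval_eq (hG : G.FullyUtilized) :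
    ∃ (x : Fin G.n → ℝ) (lam : ℝ), G.IsFeasible x ∧ (∀ e, 0 < x e) ∧
      ∀ e, (G.latency e).eval (x e) = lam := by
  obtain ⟨x, hN, hx⟩ := hG
  have hfeas := hN.isFeasible
  obtain ⟨P, -, hxP, hP⟩ := hN
  simp only [cost, noIncentive, mul_zero, add_zero] at hP
  let e₀ := P ⟨0, le_rfl, G.r_pos.le⟩
  refine ⟨x, (G.latency e₀).eval (x e₀), hfeas, hx, fun e => le_antisymm ?_ (hP _ e)⟩
  obtain ⟨z, rfl⟩ : ∃ z, P z = e := by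
    by_contra! hunused
    simpa [hxP e, hunused] using hx e
  exact hP z e₀

theorem IsFeasible.totalLatency_eq (hg : G.IsFeasible g) (hx : G.IsFeasible x)
    (hlam : ∀ e, (G.latency e).eval (x e) = lam) (ht : ∀ e, (G.latency e).a * y e = t) :
    G.totalLatency g =
      lam * G.r - ∑ e, (G.latency e).a * ((g e - x e) * (y e - g e)) := by
  have hterm : ∀ e, g e * (G.latency e).eval (g e) =
      lam * g e - (G.latency e).a * ((g e - x e) * (y e - g e)) + t * (g e - x e) := fun e => by
    rw [← ht e, ← hlam e, AffineLatency.eval, AffineLatency.eval]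
    ring
  simp only [totalLatency, hterm, Finset.sum_add_distrib, Finset.sum_sub_distrib, ← Finset.mul_sum,
    hg.2, hx.2]
  ring

theorem IsFeasible.le_totalLatency (hg : G.IsFeasible g) (hx : G.IsFeasible x)
    (hlam : ∀ e, (G.latency e).eval (x e) = lam) (ht : ∀ e, (G.latency e).a * y e = t) :
    lam * G.r - (∑ e, (G.latency e).a * (y e - x e) ^ 2) / 4 ≤ G.totalLatency g := by
  rw [hg.totalLatency_eq hx hlam ht, Finset.sum_div]
  gcongr with e
  have hamgm : (g e - x e) * (y e - g e) ≤ (y e - x e) ^ 2 / 4 := by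
    linarith [sq_nonneg (2 * g e - (x e + y e))]
  exact (mul_le_mul_of_nonneg_left hamgm (G.latency e).a_nonneg).trans_eq (by ring)

theorem IsFeasible.sum_mul_sq_le (hx : G.IsFeasible x) (hy : ∑ e, y e = G.r)
    (hlam : ∀ e, (G.latency e).eval (x e) = lam) (ht : ∀ e, (G.latency e).a * y e = t) :
    ∑ e, (G.latency e).a * (y e - x e) ^ 2 ≤ lam * G.r := by
  have hnonneg : 0 ≤ ∑ e, ((G.latency e).a * y e ^ 2 + (G.latency e).b * x e) :=
    Finset.sum_nonneg fun e _ => add_nonneg (mul_nonneg (G.latency e).a_nonneg (sq_nonneg _))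
      (mul_nonneg (G.latency e).b_nonneg (hx.1 e))
  have hterm : ∀ e, (G.latency e).a * y e ^ 2 + (G.latency e).b * x e =
      lam * x e + 2 * (t * (y e - x e)) - (G.latency e).a * (y e - x e) ^ 2 := fun e => by
    rw [← ht e, ← hlam e, AffineLatency.eval]
    ring
  simp only [hterm, Finset.sum_sub_distrib, Finset.sum_add_distrib, ← Finset.mul_sum, hy, hx.2]
    at hnonneg
  linarith

theorem IsNashFlow.exists_user_cost_le (hf : G.IsNashFlow s (affineMechanism 0 (-κ)) f)
    (hs : ∀ z, κ * s z ∈ Icc 0 1) (hx : G.IsFeasible x) (hpos : ∀ e, 0 < x e)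
    (hlam : ∀ e, (G.latency e).eval (x e) = lam) (e : Fin G.n) :
    ∃ z, ∀ e', G.cost (affineMechanism 0 (-κ)) (s z) f e ≤
      G.cost (affineMechanism 0 (-κ)) (s z) f e' := by
  have hfeas := hf.isFeasible
  obtain ⟨P, -, hfP, hP⟩ := hf
  have hunused : ∀ i, (∀ z, P z ≠ i) → f i = 0 := fun i hi => by simp [hfP, hi]
  by_contra! hworse
  have hcost : ∀ z, G.cost (affineMechanism 0 (-κ)) (s z) f (P z) <
      G.cost (affineMechanism 0 (-κ)) (s z) f e := fun z =>
    let ⟨e', he'⟩ := hworse z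
    (hP z e').trans_lt he'
  have he : f e = 0 := hunused e fun z hz => (hcost z).ne (by rw [hz])
  -- If `e` attracts nobody, every other edge has lost traffic compared with `x`.
  have hlt : ∀ i, f i < x i := by
    intro i
    by_cases hi : ∃ z, P z = i
    · obtain ⟨z, rfl⟩ := hi
      have hz := hcost z
      have hlam_e := hlam e
      have hlam_z := hlam (P z)
      simp only [cost, affineMechanism, AffineLatency.eval, he] at hz hlam_e hlam_z
      have hbe : (1 - κ * s z) * (G.latency e).b ≤ (1 - κ * s z) * lam :=
        mul_le_mul_of_nonneg_left
          (by linarith [mul_nonneg (G.latency e).a_nonneg (hpos e).le]) (sub_nonneg.2 (hs z).2)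
      have hax : 0 ≤ κ * s z * ((G.latency (P z)).a * x (P z)) :=
        mul_nonneg (hs z).1 (mul_nonneg (G.latency (P z)).a_nonneg (hpos _).le)
      rw [← hlam_z] at hbe
      exact lt_of_mul_lt_mul_left (by linarith) (G.latency (P z)).a_nonneg
    · rw [hunused i (not_exists.1 hi)]
      exact hpos i
  have hsum := Finset.sum_lt_sum_of_nonempty ⟨e, Finset.mem_univ e⟩ fun i _ => hlt i
  exact hsum.ne (hfeas.2.trans hx.2.symm)

theorem IsNashFlow.monovary (hf : G.IsNashFlow s (affineMechanism 0 (-κ)) f) (hq : 0 ≤ q)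
    (hs : ∀ z, κ * s z ∈ Icc q (1 - q)) (hx : G.IsFeasible x) (hpos : ∀ e, 0 < x e)
    (hlam : ∀ e, (G.latency e).eval (x e) = lam) (ht : ∀ e, (G.latency e).a * y e = t) :
    Monovary (fun e => (G.latency e).a * ((f e - x e) - q * (y e - x e)))
      fun e => (G.latency e).a * ((1 - q) * (y e - x e) - (f e - x e)) := by
  intro i j hij
  have hs' : ∀ z, κ * s z ∈ Icc 0 1 := fun z => ⟨hq.trans (hs z).1, by linarith [(hs z).2]⟩
  obtain ⟨z, hz⟩ := hf.exists_user_cost_le hs' hx hpos hlam i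
  have hcost : ∀ e, G.cost (affineMechanism 0 (-κ)) (s z) f e =
      (G.latency e).a * (f e - x e) - κ * s z * ((G.latency e).a * (y e - x e))
        + (lam + κ * s z * (t - lam)) := fun e => by
    rw [← ht e, ← hlam e]
    simp only [cost, affineMechanism, AffineLatency.eval]
    ring
  have hzj := hz j
  rw [hcost i, hcost j] at hzj
  simp only [mul_sub, mul_left_comm _ q, mul_left_comm _ (1 - q)] at hij hzj ⊢
  set Δ := ((G.latency j).a * y j - (G.latency j).a * x j)
    - ((G.latency i).a * y i - (G.latency i).a * x i)
  rcases le_total 0 Δ with hsign | hsign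
  · linarith [mul_le_mul_of_nonneg_right (hs z).1 hsign]
  · linarith [mul_le_mul_of_nonpos_right (hs z).2 hsign]

theorem IsNashFlow.totalLatency_le (hf : G.IsNashFlow s (affineMechanism 0 (-κ)) f) (hq : 0 ≤ q)
    (hs : ∀ z, κ * s z ∈ Icc q (1 - q)) (hx : G.IsFeasible x) (hpos : ∀ e, 0 < x e)
    (hlam : ∀ e, (G.latency e).eval (x e) = lam) (ht : ∀ e, (G.latency e).a * y e = t)
    (hy : ∑ e, y e = G.r) :
    G.totalLatency f ≤
      lam * G.r - q * (1 - q) * ∑ e, (G.latency e).a * (y e - x e) ^ 2 := by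
  have hsum : ∑ e, ((f e - x e) - q * (y e - x e)) = 0 := by
    simp only [Finset.sum_sub_distrib, ← Finset.mul_sum, hf.isFeasible.2, hx.2, hy]
    ring
  have hcheb := sum_mul_mul_nonneg_of_monovary (fun e => (G.latency e).a_nonneg) hsum
    (hf.monovary hq hs hx hpos hlam ht)
  have hterm : ∀ e, (G.latency e).a *
      (((f e - x e) - q * (y e - x e)) * ((1 - q) * (y e - x e) - (f e - x e))) =
        (G.latency e).a * ((f e - x e) * (y e - f e))
          - q * (1 - q) * ((G.latency e).a * (y e - x e) ^ 2) := fun e => by ring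
  simp only [hterm, Finset.sum_sub_distrib, ← Finset.mul_sum] at hcheb
  rw [hf.isFeasible.totalLatency_eq hx hlam ht]
  linarith

end UpperBound

end ParallelGame

/-- The price of anarchy of Pigou's network with latencies `x` and `1` when the share `ρ` of the
traffic uses the first edge; the optimal total latency is `3 / 4`. -/
noncomputable def pigouRatio (ρ : ℝ) : ℝ := 4 / 3 * (1 - ρ * (1 - ρ))

theorem ParallelGame.FullyUtilized.poa_le {G : ParallelGame} (hG : G.FullyUtilized)
    {SL SU κ q : ℝ} (hq : 0 ≤ q) (hκ : ∀ σ ∈ Icc SL SU, κ * σ ∈ Icc q (1 - q)) :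
    G.poa SL SU (affineMechanism 0 (-κ)) ≤ ENNReal.ofReal (pigouRatio q) := by
  obtain ⟨x, lam, hx, hpos, hlam⟩ := hG.exists_eval_eq
  have hne : Nonempty (Fin G.n) := by
    by_contra! hempty
    exact G.r_pos.ne (by simpa using hx.2)
  obtain ⟨y, t, ht, hy⟩ := exists_mul_eq_const_of_sum_eq (fun e => (G.latency e).a_nonneg) G.r
  have hD := hx.sum_mul_sq_le hy hlam ht
  set D := ∑ e, (G.latency e).a * (y e - x e) ^ 2
  have hqq : q * (1 - q) ≤ 1 / 4 := by linarith [sq_nonneg (2 * q - 1)]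
  have hopt : ENNReal.ofReal (lam * G.r - D / 4) ≤ G.optLatency :=
    le_iInf₂ fun g hg => ENNReal.ofReal_le_ofReal (hg.le_totalLatency hx hlam ht)
  refine iSup₂_le fun s hs => ENNReal.div_le_of_le_mul (iSup₂_le fun f hf => ?_)
  have hnash := hf.totalLatency_le hq (fun z => hκ _ (hs z)) hx hpos hlam ht hy
  calc ENNReal.ofReal (G.totalLatency f)
      ≤ ENNReal.ofReal (pigouRatio q * (lam * G.r - D / 4)) := by
        refine ENNReal.ofReal_le_ofReal (hnash.trans ?_)
        unfold pigouRatio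
        linarith [mul_nonneg (sub_nonneg.2 hqq) (sub_nonneg.2 hD)]
    _ = ENNReal.ofReal (pigouRatio q) * ENNReal.ofReal (lam * G.r - D / 4) :=
        ENNReal.ofReal_mul (by unfold pigouRatio; linarith)
    _ ≤ ENNReal.ofReal (pigouRatio q) * G.optLatency := by gcongr

section Pigou

variable {b t ρ p m q σ k₁ k₂ SL SU : ℝ}

/-- Pigou's network: unit traffic and two edges with latency functions `x` and `b`. -/
def pigouGame (b : ℝ) (hb : 0 ≤ b) : ParallelGame where
  n := 2
  latency := ![⟨1, 0, zero_le_one, le_rfl⟩, ⟨0, b, le_rfl, hb⟩]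
  r := 1
  r_pos := one_pos

/-- The share `t` of the traffic is an equilibrium share of the first edge in a two-edge network
where homogeneous users perceive the cost `p * t` on the first edge and `m` on the second. -/
def IsEquilibriumShare (p m t : ℝ) : Prop :=
  t ∈ Icc (0 : ℝ) 1 ∧ (0 < t → p * t ≤ m) ∧ (t < 1 → m ≤ p * t)

theorem pigouGame_isFeasible (hb : 0 ≤ b) (ht : t ∈ Icc (0 : ℝ) 1) :
    (pigouGame b hb).IsFeasible ![t, 1 - t] := by
  refine ⟨Fin.forall_fin_two.2 ⟨ht.1, sub_nonneg.2 ht.2⟩, ?_⟩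
  change ∑ e : Fin 2, (![t, 1 - t] : Fin 2 → ℝ) e = 1
  simp

theorem pigouGame_totalLatency (hb : 0 ≤ b) (t : ℝ) :
    (pigouGame b hb).totalLatency ![t, 1 - t] = t ^ 2 + (1 - t) * b := by
  change ∑ e : Fin 2, _ = _
  simp only [AffineLatency.eval, pigouGame, Fin.sum_univ_two, Fin.isValue, Matrix.cons_val_zero,
    Matrix.cons_val_one, Matrix.cons_val_fin_one]
  ring

theorem pigouGame_isNashFlow (hb : 0 ≤ b)
    (ht : IsEquilibriumShare (1 + σ * k₁) ((1 + σ * k₂) * b) t) :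
    (pigouGame b hb).IsNashFlow (fun _ => σ) (affineMechanism k₁ k₂) ![t, 1 - t] := by
  obtain ⟨hmem, hfst, hsnd⟩ := ht
  have hcost₀ : (pigouGame b hb).cost (affineMechanism k₁ k₂) σ ![t, 1 - t] (0 : Fin 2) =
      (1 + σ * k₁) * t := by
    simp only [ParallelGame.cost, AffineLatency.eval, affineMechanism, pigouGame, Fin.isValue,
      Matrix.cons_val_zero]
    ring
  have hcost₁ : (pigouGame b hb).cost (affineMechanism k₁ k₂) σ ![t, 1 - t] (1 : Fin 2) =
      (1 + σ * k₂) * b := by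
    simp only [ParallelGame.cost, AffineLatency.eval, affineMechanism, pigouGame, Fin.isValue,
      Matrix.cons_val_one, Matrix.cons_val_fin_one]
    ring
  refine (pigouGame_isFeasible hb hmem).isNashFlow_const
    (Fin.forall_fin_two.2 ⟨fun h => Fin.forall_fin_two.2 ⟨le_rfl, ?_⟩,
      fun h => Fin.forall_fin_two.2 ⟨?_, le_rfl⟩⟩)
  · exact hcost₀.trans_le ((hfst h).trans_eq hcost₁.symm)
  · exact hcost₁.trans_le ((hsnd (sub_pos.1 h)).trans_eq hcost₀.symm)

theorem pigouGame_mem_parallelAffineGames (hb : 0 < b) (hb1 : b < 1) :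
    pigouGame b hb.le ∈ parallelAffineGames := by
  have hN : (pigouGame b hb.le).IsNashFlow (fun _ => 1) (affineMechanism 0 0) ![b, 1 - b] :=
    pigouGame_isNashFlow hb.le (by simp [IsEquilibriumShare, hb.le, hb1.le])
  have hT : affineMechanism 0 0 = noIncentive := by
    funext ℓ x
    simp [affineMechanism, noIncentive]
  exact ⟨![b, 1 - b], hT ▸ hN, Fin.forall_fin_two.2 ⟨hb, sub_pos.2 hb1⟩⟩

theorem pigouGame_optLatency_le (hb : 0 ≤ b) (hb2 : b ≤ 2) :
    (pigouGame b hb).optLatency ≤ ENNReal.ofReal (b - b ^ 2 / 4) := by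
  refine (iInf₂_le _ (pigouGame_isFeasible hb (t := b / 2) ⟨by linarith, by linarith⟩)).trans ?_
  rw [pigouGame_totalLatency]
  exact ENNReal.ofReal_le_ofReal (by linarith)

theorem IsEquilibriumShare.ofReal_le_familyPoA (hb : 0 < b) (hb1 : b < 1) (hσ : σ ∈ Icc SL SU)
    (ht : IsEquilibriumShare (1 + σ * k₁) ((1 + σ * k₂) * b) t) :
    ENNReal.ofReal ((t ^ 2 + (1 - t) * b) / (b - b ^ 2 / 4)) ≤
      familyPoA parallelAffineGames SL SU (affineMechanism k₁ k₂) := by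
  have hden : 0 < b - b ^ 2 / 4 := by linarith [mul_pos hb (sub_pos.2 hb1)]
  rw [ENNReal.ofReal_div_of_pos hden, ← pigouGame_totalLatency hb.le]
  calc _ ≤ (pigouGame b hb.le).nashLatency (fun _ => σ) (affineMechanism k₁ k₂) /
        (pigouGame b hb.le).optLatency :=
        ENNReal.div_le_div (le_iSup₂_of_le _ (pigouGame_isNashFlow hb.le ht) le_rfl)
          (pigouGame_optLatency_le hb.le (by linarith))
    _ ≤ familyPoA parallelAffineGames SL SU (affineMechanism k₁ k₂) :=
        le_iSup₂_of_le _ (pigouGame_mem_parallelAffineGames hb hb1)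
          (le_iSup₂_of_le (fun _ => σ) (fun _ => hσ) le_rfl)

theorem IsEquilibriumShare.exists_tendsto (hρ : IsEquilibriumShare p m ρ) :
    ∃ t : ℝ → ℝ, Tendsto t (𝓝[<] 1) (𝓝 ρ) ∧
      ∀ᶠ b in 𝓝[<] (1 : ℝ), IsEquilibriumShare p (m * b) (t b) := by
  obtain ⟨hmem, hfst, hsnd⟩ := hρ
  have hid : Tendsto (fun b : ℝ => b) (𝓝[<] 1) (𝓝 1) :=
    tendsto_nhdsWithin_of_tendsto_nhds tendsto_id
  have hm : Tendsto (fun b => m * b) (𝓝[<] 1) (𝓝 m) := by simpa using hid.const_mul m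
  rcases lt_trichotomy (p * ρ) m with hlt | heq | hgt
  · refine ⟨fun _ => ρ, tendsto_const_nhds, ?_⟩
    filter_upwards [hm.eventually (lt_mem_nhds hlt)] with b hb
    exact ⟨hmem, fun _ => hb.le, fun h => absurd (hsnd h) hlt.not_ge⟩
  · refine ⟨fun b => ρ * b, by simpa using hid.const_mul ρ, ?_⟩
    filter_upwards [hid.eventually (lt_mem_nhds one_pos), self_mem_nhdsWithin] with b hb0 hb1
    have hpb : p * (ρ * b) = m * b := by rw [← mul_assoc, heq]
    exact ⟨⟨mul_nonneg hmem.1 hb0.le, mul_le_one₀ hmem.2 hb0.le (le_of_lt hb1)⟩,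
      fun _ => hpb.le, fun _ => hpb.ge⟩
  · refine ⟨fun _ => ρ, tendsto_const_nhds, ?_⟩
    filter_upwards [hm.eventually (gt_mem_nhds hgt)] with b hb
    exact ⟨hmem, fun h => absurd (hfst h) hgt.not_ge, fun _ => hb.le⟩

-- The network with `b = 1` is not fully utilized, so its ratio is only approached as `b → 1`.
theorem IsEquilibriumShare.pigouRatio_le_familyPoA (hσ : σ ∈ Icc SL SU)
    (hρ : IsEquilibriumShare (1 + σ * k₁) (1 + σ * k₂) ρ) :
    ENNReal.ofReal (pigouRatio ρ) ≤
      familyPoA parallelAffineGames SL SU (affineMechanism k₁ k₂) := by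
  obtain ⟨t, htρ, ht⟩ := hρ.exists_tendsto
  have hid : Tendsto (fun b : ℝ => b) (𝓝[<] 1) (𝓝 1) :=
    tendsto_nhdsWithin_of_tendsto_nhds tendsto_id
  have hlim : Tendsto (fun b => (t b ^ 2 + (1 - t b) * b) / (b - b ^ 2 / 4)) (𝓝[<] 1)
      (𝓝 ((ρ ^ 2 + (1 - ρ) * 1) / (1 - 1 ^ 2 / 4))) :=
    ((htρ.pow 2).add ((htρ.const_sub 1).mul hid)).div (hid.sub ((hid.pow 2).div_const 4))
      (by norm_num)
  have hval : (ρ ^ 2 + (1 - ρ) * 1) / (1 - 1 ^ 2 / 4) = pigouRatio ρ := by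
    unfold pigouRatio
    ring
  rw [hval] at hlim
  refine le_of_tendsto (ENNReal.tendsto_ofReal hlim) ?_
  filter_upwards [ht, hid.eventually (lt_mem_nhds one_pos), self_mem_nhdsWithin] with b hb hb0 hb1
  exact hb.ofReal_le_familyPoA hb0 hb1 hσ

theorem exists_isEquilibriumShare_lt (hq : q ∈ Ioc (0 : ℝ) 1) (h : m < p * q) :
    ∃ ρ < q, IsEquilibriumShare p m ρ := by
  rcases le_or_gt m 0 with hm | hm
  · exact ⟨0, hq.1, ⟨le_rfl, zero_le_one⟩, fun h => absurd h (lt_irrefl _), fun _ => by simpa⟩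
  · have hp : 0 < p := pos_of_mul_pos_left (hm.trans h) hq.1.le
    have hlt : m / p < q := (div_lt_iff₀' hp).2 h
    have heq : p * (m / p) = m := mul_div_cancel₀ m hp.ne'
    exact ⟨m / p, hlt, ⟨by positivity, hlt.le.trans hq.2⟩, fun _ => heq.le, fun _ => heq.ge⟩

theorem exists_gt_isEquilibriumShare (hq : q ∈ Ico (0 : ℝ) 1) (h : p * q < m) :
    ∃ ρ > q, IsEquilibriumShare p m ρ := by
  rcases le_or_gt p m with hm | hm
  · exact ⟨1, hq.2, ⟨zero_le_one, le_rfl⟩, fun _ => by simpa, fun h => absurd h (lt_irrefl _)⟩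
  · have hp : 0 < p := pos_of_mul_pos_left (by linarith : 0 < p * (1 - q)) (sub_nonneg.2 hq.2.le)
    have heq : p * (m / p) = m := mul_div_cancel₀ m hp.ne'
    have hlt : q < m / p := (lt_div_iff₀' hp).2 h
    exact ⟨m / p, hlt, ⟨hq.1.trans hlt.le, ((div_lt_one hp).2 hm).le⟩, fun _ => heq.le,
      fun _ => heq.ge⟩

theorem exists_isEquilibriumShare (p m : ℝ) : ∃ ρ, IsEquilibriumShare p m ρ := by
  rcases lt_trichotomy m (p * (1 / 2)) with h | h | h
  · exact (exists_isEquilibriumShare_lt (by norm_num) h).imp fun _ => And.right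
  · exact ⟨1 / 2, by norm_num, fun _ => h.ge, fun _ => h.le⟩
  · exact (exists_gt_isEquilibriumShare (by norm_num) h).imp fun _ => And.right

end Pigou

section Optimality

variable {q ρ σ κ k₁ k₂ SL SU : ℝ}

theorem pigouRatio_half_le (ρ : ℝ) : pigouRatio (1 / 2) ≤ pigouRatio ρ := by
  unfold pigouRatio
  linarith [sq_nonneg (2 * ρ - 1)]

theorem pigouRatio_one_sub (ρ : ℝ) : pigouRatio (1 - ρ) = pigouRatio ρ := by
  unfold pigouRatio
  ring

theorem pigouRatio_strictAntiOn : StrictAntiOn pigouRatio (Iic (1 / 2)) := by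
  intro ρ _ q hq hlt
  have hprod : 0 < (q - ρ) * (1 - q - ρ) :=
    mul_pos (sub_pos.2 hlt) (by linarith [mem_Iic.1 hq])
  unfold pigouRatio
  linarith

theorem ofReal_pigouRatio_lt (hq : q ≤ 1 / 2) (hlt : ρ < q) :
    ENNReal.ofReal (pigouRatio q) < ENNReal.ofReal (pigouRatio ρ) := by
  have h := pigouRatio_strictAntiOn (mem_Iic.2 (hlt.le.trans hq)) (mem_Iic.2 hq) hlt
  have hpos : 0 < pigouRatio (1 / 2) := by norm_num [pigouRatio]
  exact (ENNReal.ofReal_lt_ofReal_iff (hpos.trans_le (pigouRatio_half_le ρ))).2 h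

theorem pigouRatio_half_le_familyPoA (hσ : σ ∈ Icc SL SU) (k₁ k₂ : ℝ) :
    ENNReal.ofReal (pigouRatio (1 / 2)) ≤
      familyPoA parallelAffineGames SL SU (affineMechanism k₁ k₂) := by
  obtain ⟨ρ, hρ⟩ := exists_isEquilibriumShare (1 + σ * k₁) (1 + σ * k₂)
  exact (ENNReal.ofReal_le_ofReal (pigouRatio_half_le ρ)).trans (hρ.pigouRatio_le_familyPoA hσ)

theorem pigouRatio_lt_familyPoA_of_lt_mul (hσ : σ ∈ Icc SL SU) (hq : q ∈ Ioc 0 (1 / 2))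
    (h : 1 + σ * k₂ < (1 + σ * k₁) * q) :
    ENNReal.ofReal (pigouRatio q) <
      familyPoA parallelAffineGames SL SU (affineMechanism k₁ k₂) := by
  obtain ⟨ρ, hρq, hρ⟩ := exists_isEquilibriumShare_lt ⟨hq.1, by linarith [hq.2]⟩ h
  exact (ofReal_pigouRatio_lt hq.2 hρq).trans_le (hρ.pigouRatio_le_familyPoA hσ)

theorem pigouRatio_lt_familyPoA_of_mul_lt (hσ : σ ∈ Icc SL SU) (hq : q ∈ Ioc 0 (1 / 2))
    (h : (1 + σ * k₁) * (1 - q) < 1 + σ * k₂) :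
    ENNReal.ofReal (pigouRatio q) <
      familyPoA parallelAffineGames SL SU (affineMechanism k₁ k₂) := by
  obtain ⟨ρ, hρq, hρ⟩ :=
    exists_gt_isEquilibriumShare ⟨by linarith [hq.2], by linarith [hq.1]⟩ h
  have hlt := ofReal_pigouRatio_lt hq.2 (sub_lt_comm.1 hρq)
  rw [pigouRatio_one_sub] at hlt
  exact hlt.trans_le (hρ.pigouRatio_le_familyPoA hσ)

theorem pigouRatio_lt_familyPoA (hSL : 0 < SL) (hSU : SL ≤ SU) (hκ : 0 < κ)
    (hκS : κ * (SL + SU) ≤ 1) (hk₁ : k₁ ≤ 0)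
    (hk₂ : -κ ≤ k₂ ∨ κ * (SL + SU) = 1 ∧ SL < SU) (hne : (k₁, k₂) ≠ (0, -κ)) :
    ENNReal.ofReal (pigouRatio (κ * SL)) <
      familyPoA parallelAffineGames SL SU (affineMechanism k₁ k₂) := by
  have hκSL : 0 < κ * SL := mul_pos hκ hSL
  have hκSU : κ * SL ≤ κ * SU := mul_le_mul_of_nonneg_left hSU hκ.le
  have hq : κ * SL ∈ Ioc 0 (1 / 2) := ⟨hκSL, by linarith⟩
  by_contra! hle
  have hlow : (1 + SU * k₁) * (κ * SL) ≤ 1 + SU * k₂ := not_lt.1 fun h =>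
    (pigouRatio_lt_familyPoA_of_lt_mul ⟨hSU, le_rfl⟩ hq h).not_ge hle
  have hhigh : 1 + SL * k₂ ≤ (1 + SL * k₁) * (1 - κ * SL) := not_lt.1 fun h =>
    (pigouRatio_lt_familyPoA_of_mul_lt ⟨le_rfl, hSU⟩ hq h).not_ge hle
  have hupper : k₂ + κ ≤ k₁ * (1 - κ * SL) := le_of_mul_le_mul_left (by linarith) hSL
  have hlower : k₁ * (κ * SL) ≤ k₂ + κ := by
    rcases hk₂ with hk₂ | ⟨hbal, -⟩
    · linarith [mul_nonpos_of_nonpos_of_nonneg hk₁ hκSL.le]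
    · exact le_of_mul_le_mul_left (by linarith) (hSL.trans_le hSU)
  have hnonneg : 0 ≤ k₁ := by
    rcases hk₂ with hk₂ | ⟨-, hlt⟩
    · exact nonneg_of_mul_nonneg_left (by linarith) (by linarith [hq.2] : 0 < 1 - κ * SL)
    · have hgap : 0 < 1 - 2 * (κ * SL) := by linarith [mul_lt_mul_of_pos_left hlt hκ]
      exact nonneg_of_mul_nonneg_left (by linarith) hgap
  obtain rfl := hk₁.antisymm hnonneg
  exact hne (Prod.ext rfl (by linarith))

theorem pigouRatio_le_familyPoA (hSL : 0 < SL) (hSU : SL ≤ SU) (hκ : 0 < κ)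
    (hκS : κ * (SL + SU) ≤ 1) (hk₁ : k₁ ≤ 0) (hk₂ : -κ ≤ k₂ ∨ κ * (SL + SU) = 1)
    (hne : (k₁, k₂) ≠ (0, -κ)) :
    ENNReal.ofReal (pigouRatio (κ * SL)) ≤
      familyPoA parallelAffineGames SL SU (affineMechanism k₁ k₂) := by
  rcases hSU.eq_or_lt with rfl | hlt
  · rcases hk₂ with hk₂ | hbal
    · exact (pigouRatio_lt_familyPoA hSL le_rfl hκ hκS hk₁ (.inl hk₂) hne).le
    · rw [show κ * SL = 1 / 2 by linarith]
      exact pigouRatio_half_le_familyPoA ⟨le_rfl, le_rfl⟩ k₁ k₂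
  · exact (pigouRatio_lt_familyPoA hSL hSU hκ hκS hk₁
      (hk₂.imp_right fun hbal => ⟨hbal, hlt⟩) hne).le

theorem familyPoA_le (hSL : 0 ≤ SL) (hκ : 0 ≤ κ) (hκS : κ * (SL + SU) ≤ 1) :
    familyPoA parallelAffineGames SL SU (affineMechanism 0 (-κ)) ≤
      ENNReal.ofReal (pigouRatio (κ * SL)) :=
  iSup₂_le fun _ hG => ParallelGame.FullyUtilized.poa_le hG (mul_nonneg hκ hSL) fun _ hσ =>
    ⟨mul_le_mul_of_nonneg_left hσ.1 hκ, by linarith [mul_le_mul_of_nonneg_left hσ.2 hκ]⟩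

theorem pigouRatio_one_div_add_mul (hSL : 0 < SL) (hSU : 0 < SU) :
    pigouRatio (1 / (SL + SU) * SL) = 4 / 3 * (1 - SL / SU / (1 + SL / SU) ^ 2) := by
  unfold pigouRatio
  field_simp
  ring

end Optimality

theorem proposition4_general (SL SU β : ℝ) (hSL : 0 < SL) (hSU : SL ≤ SU) (hβ : 0 < β)
    {K : Set (ℝ × ℝ)} (hK : K ⊆ Iic 0 ×ˢ Ici (-β))
    (hmem : ((0 : ℝ), -min β (1 / (SL + SU))) ∈ K) :
    let F := fun k : ℝ × ℝ => familyPoA parallelAffineGames SL SU (affineMechanism k.1 k.2)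
    ((0 : ℝ), -min β (1 / (SL + SU))) ∈ {k | k ∈ K ∧ IsMinOn F K k} ∧
    (SL < SU ∨ β ≤ 1 / (SL + SU) →
      {k | k ∈ K ∧ IsMinOn F K k} = {((0 : ℝ), -min β (1 / (SL + SU)))}) ∧
    ∀ G ∈ parallelAffineGames,
      (β < 1 / (SL + SU) →
        G.poa SL SU (affineMechanism 0 (-min β (1 / (SL + SU)))) ≤
          ENNReal.ofReal (4 / 3 * (1 - β * SL * (1 - β * SL)))) ∧
      (1 / (SL + SU) ≤ β →
        G.poa SL SU (affineMechanism 0 (-min β (1 / (SL + SU)))) ≤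
          ENNReal.ofReal (4 / 3 * (1 - SL / SU / (1 + SL / SU) ^ 2))) := by
  intro F
  have hS : 0 < SL + SU := by linarith
  set κ := min β (1 / (SL + SU)) with hκ_def
  have hκ : 0 < κ := lt_min hβ (one_div_pos.2 hS)
  have hκS : κ * (SL + SU) ≤ 1 := (le_div_iff₀ hS).1 (min_le_right _ _)
  have hbal : 1 / (SL + SU) ≤ β → κ * (SL + SU) = 1 := fun h => by
    rw [hκ_def, min_eq_right h, one_div_mul_cancel hS.ne']
  have hK₂ : ∀ k ∈ K, β ≤ 1 / (SL + SU) → -κ ≤ k.2 := fun k hk h => by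
    rw [hκ_def, min_eq_left h]
    exact (hK hk).2
  have hF : F (0, -κ) ≤ ENNReal.ofReal (pigouRatio (κ * SL)) := familyPoA_le hSL.le hκ.le hκS
  have hmin : IsMinOn F K (0, -κ) := fun k hk => by
    rcases eq_or_ne k (0, -κ) with rfl | hne
    · exact le_refl (F _)
    · exact hF.trans (pigouRatio_le_familyPoA hSL hSU hκ hκS (hK hk).1
        ((le_total β _).imp (hK₂ k hk) hbal) hne)
  refine ⟨⟨hmem, hmin⟩, fun huniq => ?_, fun G hG => ?_⟩
  · refine eq_singleton_iff_unique_mem.2 ⟨⟨hmem, hmin⟩, fun k ⟨hk, hkmin⟩ => ?_⟩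
    by_contra hne
    refine (pigouRatio_lt_familyPoA hSL hSU hκ hκS (hK hk).1 ?_ hne).not_ge ((hkmin hmem).trans hF)
    rcases le_total β (1 / (SL + SU)) with hle | hge
    · exact .inl (hK₂ k hk hle)
    · exact huniq.symm.imp (hK₂ k hk) fun hlt => ⟨hbal hge, hlt⟩
  · have hpoa : G.poa SL SU (affineMechanism 0 (-κ)) ≤ ENNReal.ofReal (pigouRatio (κ * SL)) :=
      (le_iSup₂ (f := fun G _ => ParallelGame.poa G SL SU _) G hG).trans hF
    refine ⟨fun hlt => ?_, fun hle => ?_⟩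
    · rwa [hκ_def, min_eq_left hlt.le] at hpoa ⊢
    · rwa [hκ_def, min_eq_right hle, pigouRatio_one_div_add_mul hSL (hSL.trans_le hSU),
        ← min_eq_right hle] at hpoa

theorem proposition4 (SL SU β : ℝ) (hSL : 0 < SL) (hSU : SL ≤ SU) (hβ : 0 < β) :
    ((0 : ℝ), -min β (1 / (SL + SU))) ∈ optimalSubsidyCoeffs SL SU β ∧
    (SL < SU ∨ β ≤ 1 / (SL + SU) →
      optimalSubsidyCoeffs SL SU β = {((0 : ℝ), -min β (1 / (SL + SU)))}) ∧
    ∀ G ∈ parallelAffineGames,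
      (β < 1 / (SL + SU) →
        G.poa SL SU (affineMechanism 0 (-min β (1 / (SL + SU)))) ≤
          ENNReal.ofReal (4 / 3 * (1 - β * SL * (1 - β * SL)))) ∧
      (1 / (SL + SU) ≤ β →
        G.poa SL SU (affineMechanism 0 (-min β (1 / (SL + SU)))) ≤
          ENNReal.ofReal (4 / 3 * (1 - SL / SU / (1 + SL / SU) ^ 2))) := by
  exact proposition4_general SL SU β hSL hSU hβ
    (prod_mono Icc_subset_Iic_self Icc_subset_Ici_self)
    ⟨⟨neg_nonpos.2 hβ.le, le_rfl⟩, neg_le_neg (min_le_left _ _),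
      neg_nonpos.2 (le_min hβ.le (one_div_nonneg.2 (by linarith)))⟩
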